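/- All graphs are finite and simple (no loops, no multiple edges). A \emph{kite} in a graph $G$ is a (not necessarily induced) subgraph of $G$ formed by two distinct 3-cycles that share an edge. A graph $G$ is \emph{$k$-total-choosable} if, for every assignment of a list $L(x)$ of at least $k$ colors to each $x\in V(G)\cup E(G)$, one can choose for each $x$ a color from $L(x)$ so that adjacent vertices, adjacent edges, and incident vertex--edge pairs always receive different colors. The \emph{list total chromatic number} $\chi''_l(G)$ is the least integer $k$ such that $G$ is $k$-total-choosable, and $\Delta(G)$ denotes the maximum degree of $G$. \textbf{Theorem.} If $G$ is a planar graph that contains no kites and $\Delta(G)\ge 7$, then $\chi''_l(G)\le \Delta(G)+2$. -/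

import Mathlib

namespace SimpleGraph

universe u

/-- A rotation system of `G` (a combinatorial embedding of `G` in an oriented surface): a
permutation `next` of the darts (oriented edges) of `G` whose cycles are exactly the sets of darts
with a common starting vertex, that is, a cyclic order of the edges around each vertex. -/
structure RotationSystem {V : Type u} (G : SimpleGraph V) where
  /-- The next dart in the cyclic order around the starting vertex. -/
  next : Equiv.Perm G.Dart
  fst_next : ∀ d : G.Dart, (next d).fst = d.fst
  sameCycle_of_fst_eq : ∀ d e : G.Dart, d.fst = e.fst → next.SameCycle d e

namespace RotationSystem

variable {V : Type u} {G : SimpleGraph V}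

/-- The face tracing permutation: traverse the dart `d` from `u` to `v`, then leave `v` along the
dart that follows the reversal of `d` in the cyclic order around `v`. -/
def facePerm (R : RotationSystem G) : Equiv.Perm G.Dart :=
  (Function.Involutive.toPerm Dart.symm Dart.symm_involutive).trans R.next

/-- The faces of an embedding, component by component: the orbits of the face tracing permutation
(the facial walks), and one face for each isolated vertex (a one-point component, drawn on
a sphere of its own, has a single face, whose boundary carries no dart). -/
abbrev Face (R : RotationSystem G) : Type u :=
  Quotient (Equiv.Perm.SameCycle.setoid R.facePerm) ⊕ {v : V // ∀ w, ¬ G.Adj v w}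

/-- The Euler characteristic `|V| - |E| + |F|` of the surface obtained by gluing a disc along each
facial walk (one closed connected oriented surface for each component of the graph). -/
noncomputable def eulerChar (R : RotationSystem G) : ℤ :=
  (Nat.card V : ℤ) - (Nat.card G.edgeSet : ℤ) + (Nat.card R.Face : ℤ)

end RotationSystem

/-- A finite graph is planar if it has an embedding of genus `0`, that is, a rotation system for
which each connected component is embedded in a sphere. A component that is embedded in a closed
oriented surface of genus `g` contributes `2 - 2 * g` to the Euler characteristic, so all of them
have genus `0` precisely if the Euler characteristic is twice the number of components. -/
def IsPlanar {V : Type u} (G : SimpleGraph V) : Prop :=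
  ∃ R : RotationSystem G, R.eulerChar = 2 * (Nat.card G.ConnectedComponent : ℤ)

/-- `G` contains a kite: two different 3-cycles `a b c` and `a b d` that share the edge `a b`
(as a subgraph, not necessarily induced). -/
def HasKite {V : Type u} (G : SimpleGraph V) : Prop :=
  ∃ a b c d : V, c ≠ d ∧ G.Adj a b ∧ G.Adj a c ∧ G.Adj b c ∧ G.Adj a d ∧ G.Adj b d

/-- Two elements (vertices or edges) of `G` conflict in a total colouring: adjacent vertices,
a vertex and an edge incident to it, different edges with a common endpoint. -/
def TotalConflict {V : Type u} (G : SimpleGraph V) : V ⊕ G.edgeSet → V ⊕ G.edgeSet → Prop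
  | Sum.inl u, Sum.inl v => G.Adj u v
  | Sum.inl u, Sum.inr e => u ∈ (e : Sym2 V)
  | Sum.inr e, Sum.inl u => u ∈ (e : Sym2 V)
  | Sum.inr e, Sum.inr f => e ≠ f ∧ ∃ v : V, v ∈ (e : Sym2 V) ∧ v ∈ (f : Sym2 V)

/-- A proper total colouring: adjacent or incident elements receive different colours. -/
def IsProperTotalColoring {V : Type u} (G : SimpleGraph V) {α : Type*}
    (c : V ⊕ G.edgeSet → α) : Prop :=
  ∀ x y, G.TotalConflict x y → c x ≠ c y

/-- `G` is `k`-total-choosable: for all lists of at least `k` colours on the vertices and edges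
there is a proper total colouring in which each element has a colour of its own list. -/
def IsTotalChoosable {V : Type u} (G : SimpleGraph V) (k : ℕ) : Prop :=
  ∀ (α : Type) (L : V ⊕ G.edgeSet → Finset α), (∀ x, k ≤ (L x).card) →
    ∃ c : V ⊕ G.edgeSet → α, G.IsProperTotalColoring c ∧ ∀ x, c x ∈ L x

/-- The list total chromatic number: the least `k` for which `G` is `k`-total-choosable
(`⊤` if there were none). -/
noncomputable def listTotalChromaticNumber {V : Type u} (G : SimpleGraph V) : ℕ∞ :=
  ⨅ k ∈ {k : ℕ | G.IsTotalChoosable k}, (k : ℕ∞)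

end SimpleGraph

/-! Induction on the number of edges, with K = Δ(G) and the lists fixed. It suffices to find an edge
uv with deg u ≤ 4 and deg u + deg v ≤ K + 2: colour G − uv and uncolour u. Then uv has at most K + 1
forbidden colours, and afterwards u has at most 8, both fewer than K + 2 ≥ 9
(`exists_totalColoringPair_of_deleteEdges`).

Such an edge exists by discharging (`exists_light_edge`). Otherwise non-isolated vertices have
degree at least 3, vertices of degree at most 4 are pairwise non-adjacent, and neighbours of
3-vertices have degree at least K. Give each non-isolated v the charge 6 deg v − 24; by Euler's
formula the total is less than 6 per triangular face. Each 3-vertex takes 2 from every neighbour,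
and each triangular face takes 3 from every corner of degree at least 5, of which it has at least
two. Without kites, triangular corners at a vertex are never consecutive, so no vertex is overdrawn
and every triangle receives 6, a contradiction.

The induction needs planarity to survive edge deletion. For rotation systems this is a count of
permutation cycles under transpositions (`exists_deleteEdges`). -/

/-- A map between finite types that is injective away from one point loses at most one element. -/
lemma Nat.card_le_card_add_one_of_injOn_compl {A B : Type*} [Finite A] [Finite B] (f : A → B) (p : A)
    (hf : ∀ x y, f x = f y → x ≠ p → y ≠ p → x = y) : Nat.card A ≤ Nat.card B + 1 := by
  classical
  rw [← Finite.card_option]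
  refine Nat.card_le_card_of_injective (fun x => if x = p then none else some (f x)) ?_
  intro x y h
  by_cases hx : x = p <;> by_cases hy : y = p <;> simp_all
  exact hf x y h hx hy

/-! ### Cycle counts under multiplication by a transposition -/

namespace Equiv.Perm

variable {D : Type*}

/-- The number of cycles of a permutation, fixed points included. -/
noncomputable def cycleCount (π : Perm D) : ℕ := Nat.card (Quotient (SameCycle.setoid π))

/-- The cycle of a permutation through a point. -/
def cycleMk (π : Perm D) (x : D) : Quotient (SameCycle.setoid π) := Quotient.mk _ x

lemma cycleMk_eq_iff {π : Perm D} {x y : D} : cycleMk π x = cycleMk π y ↔ π.SameCycle x y :=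
  Quotient.eq

lemma cycleMk_apply (π : Perm D) (z : D) : cycleMk π (π z) = cycleMk π z :=
  cycleMk_eq_iff.2 (sameCycle_apply_left.2 (SameCycle.refl _ _))

lemma SameCycle.apply_eq_of_invariant {π : Perm D} {β : Type*} {f : D → β}
    (hf : ∀ z, f (π z) = f z) {x y : D} (h : π.SameCycle x y) : f x = f y := by
  obtain ⟨i, rfl⟩ := h
  have key : ∀ i : ℤ, ∀ x, f ((π ^ i) x) = f x := by
    intro i
    induction i with
    | zero => simp
    | succ n ih => intro x; rw [zpow_add_one, mul_apply, ih, hf]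
    | pred n ih =>
      intro x
      rw [zpow_sub_one, mul_apply, ih, ← hf (π⁻¹ x),
        show π (π⁻¹ x) = x from π.apply_symm_apply x]
  exact (key i x).symm

variable [DecidableEq D]

section Finite

variable [Finite D]

/-- Once the cycles of a and b are identified, the class of a point is invariant under `π * swap a
b`. Hence every cycle of `π` except that of b comes from a cycle of the product. -/
lemma cycleCount_le_mul_swap_add_one (π : Perm D) (a b : D) :
    π.cycleCount ≤ (π * swap a b).cycleCount + 1 := by
  classical
  let q := cycleMk π
  have hq : ∀ z, q (π z) = q z := cycleMk_apply π
  let g : Quotient (SameCycle.setoid π) → Quotient (SameCycle.setoid π) :=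
    fun x => if x = q b then q a else x
  have hg : g (q a) = q a := by simp [g]
  have hgb : g (q b) = q a := by simp [g]
  have hinv : ∀ z, g (q ((π * swap a b) z)) = g (q z) := by
    intro z
    rw [mul_apply, hq]
    rcases eq_or_ne z a with rfl | ha
    · rw [swap_apply_left, hg, hgb]
    rcases eq_or_ne z b with rfl | hb
    · rw [swap_apply_right, hg, hgb]
    rw [swap_apply_of_ne_of_ne ha hb]
  let f : Option (Quotient (SameCycle.setoid (π * swap a b))) → Quotient (SameCycle.setoid π)
    | none => q b
    | some x => Quotient.lift (fun z => g (q z))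
        (fun _ _ h => SameCycle.apply_eq_of_invariant (f := fun z => g (q z)) hinv h) x
  rw [cycleCount, cycleCount, ← Finite.card_option]
  refine Nat.card_le_card_of_surjective f fun x => ?_
  by_cases hx : x = q b
  · exact ⟨none, hx.symm⟩
  · induction x using Quotient.inductionOn with
    | h z => exact ⟨some (Quotient.mk _ z), if_neg hx⟩

/-- The cycles of the product refine those of `π`, and strictly so because they separate a from b.
-/
lemma cycleCount_add_one_le_mul_swap {π : Perm D} {a b : D} (hab : a ≠ b)
    (h : π.SameCycle a b) : π.cycleCount + 1 ≤ (π * swap a b).cycleCount := by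
  classical
  set ρ := π * swap a b with hρ
  let q := cycleMk π
  have hq : ∀ z, q (π z) = q z := cycleMk_apply π
  have hqab : q a = q b := Quotient.sound h
  have hinv : ∀ z, q (ρ z) = q z := by
    intro z
    rw [hρ, mul_apply, hq]
    rcases eq_or_ne z a with rfl | ha
    · rw [swap_apply_left, hqab]
    rcases eq_or_ne z b with rfl | hb
    · rw [swap_apply_right, hqab]
    rw [swap_apply_of_ne_of_ne ha hb]
  let f : Quotient (SameCycle.setoid ρ) → Quotient (SameCycle.setoid π) :=
    Quotient.lift q (fun _ _ h => SameCycle.apply_eq_of_invariant (f := q) hinv h)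
  have hsurj : Function.Surjective f := fun x => by
    induction x using Quotient.inductionOn with
    | h z => exact ⟨Quotient.mk _ z, rfl⟩
  have hnot : ¬ ρ.SameCycle a b := by
    intro hs
    have hex : ∃ k, 0 < k ∧ (π ^ k) b = a := by
      obtain ⟨k, hk, -, hk'⟩ := h.symm.exists_pow_eq''
      exact ⟨k, hk, hk'⟩
    let k := Nat.find hex
    obtain ⟨hk0, hk⟩ : 0 < k ∧ (π ^ k) b = a := Nat.find_spec hex
    have hmin : ∀ i, 0 < i → i < k → (π ^ i) b ≠ a := fun i h0 hi h' =>
      Nat.find_min hex hi ⟨h0, h'⟩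
    have hb : ∀ i, 0 < i → i ≤ k → (π ^ i) b ≠ b := by
      intro i h0 hi h'
      rcases hi.eq_or_lt with rfl | hi
      · exact hab (hk.symm.trans h')
      · refine hmin (k - i) (by omega) (by omega) ?_
        rw [← hk]
        conv_rhs => rw [← Nat.sub_add_cancel hi.le, pow_add, mul_apply, h']
    -- The arc of the `π`-cycle from just after b up to a. The product sends a back to `π b`, so its
    -- orbit of a never leaves this arc, which misses b.
    let S : Set D := {x | ∃ i, 0 < i ∧ i ≤ k ∧ (π ^ i) b = x}
    have hS : ∀ n : ℕ, (ρ ^ n) a ∈ S := by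
      intro n
      induction n with
      | zero => exact ⟨k, hk0, le_rfl, hk⟩
      | succ n ih =>
        obtain ⟨i, h0, hi, h'⟩ := ih
        rw [pow_succ', mul_apply, ← h', hρ, mul_apply]
        rcases hi.eq_or_lt with rfl | hi
        · rw [hk, swap_apply_left]
          exact ⟨1, one_pos, hk0, by simp⟩
        · rw [swap_apply_of_ne_of_ne (hmin i h0 hi) (hb i h0 hi.le)]
          exact ⟨i + 1, by omega, hi, by rw [pow_succ', mul_apply]⟩
    obtain ⟨n, -, hn⟩ := hs.exists_pow_eq'
    obtain ⟨i, h0, hi, h'⟩ := hS n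
    exact hb i h0 hi (h'.trans hn)
  by_contra hlt
  have hle : (ρ.cycleCount) ≤ π.cycleCount := by omega
  have hbij : Function.Bijective f :=
    (Nat.bijective_iff_surjective_and_card f).2 ⟨hsurj,
      le_antisymm hle (Nat.card_le_card_of_surjective f hsurj)⟩
  exact hnot (Quotient.exact (hbij.1 (a₁ := Quotient.mk _ a) (a₂ := Quotient.mk _ b) hqab))

/-- Turning `x` into a fixed point splits it off its cycle. -/
lemma cycleCount_add_le_swap_mul (π : Perm D) (x : D) :
    π.cycleCount + (if π x = x then 0 else 1) ≤ (swap x (π x) * π).cycleCount := by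
  split_ifs with h
  · rw [h, swap_self]
    exact le_rfl
  · have h1 : swap x (π x) * π = π * swap (π⁻¹ x) x := by
      rw [mul_swap_eq_swap_mul, show π (π⁻¹ x) = x from π.apply_symm_apply x]
    rw [h1]
    refine cycleCount_add_one_le_mul_swap ?_ ?_
    · intro h2
      exact h (by rw [Perm.inv_eq_iff_eq] at h2; exact h2.symm)
    · exact ⟨1, by simp⟩

end Finite

lemma swap_mul_apply_self (π : Perm D) (x : D) : (swap x (π x) * π) x = x := by
  simp

lemma swap_mul_apply_of_ne (π : Perm D) {x y : D} (h : y ≠ x) (h' : π y ≠ x) :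
    (swap x (π x) * π) y = π y := by
  rw [mul_apply, swap_apply_of_ne_of_ne h' (fun h2 => h (π.injective h2))]

lemma SameCycle.swap_mul {π : Perm D} {x y z : D} (h : π.SameCycle y z) (hy : y ≠ x)
    (hz : z ≠ x) : (swap x (π x) * π).SameCycle y z := by
  set ρ := swap x (π x) * π with hρ
  let q := cycleMk ρ
  have hq : ∀ z, q (ρ z) = q z := cycleMk_apply ρ
  -- The excised point x is put in the class of its predecessor, which makes the class invariant
  -- under `π`.
  let f : D → Quotient (SameCycle.setoid ρ) := fun z => if z = x then q (π⁻¹ x) else q z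
  have hinv : ∀ z, f (π z) = f z := by
    intro z
    by_cases hzx : z = x <;> by_cases hpz : π z = x
    · rw [hzx] at hpz ⊢
      rw [hpz]
    · subst hzx
      have : ρ (π⁻¹ z) = π z := by simp [hρ]
      simp only [f, hpz, if_false, if_true]
      rw [← this, hq]
    · simp [f, ← hpz]
    · simp only [f, hzx, hpz, if_false]
      rw [← hq z, show ρ z = π z from swap_mul_apply_of_ne π hzx hpz]
  have := SameCycle.apply_eq_of_invariant hinv h
  simp only [f, hy, hz, if_false] at this
  exact cycleMk_eq_iff.1 this

end Equiv.Perm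

namespace SimpleGraph

universe u

open Equiv.Perm

/-! ### Deleting an edge does not increase the genus -/

section Deletion

variable {V : Type u} {G : SimpleGraph V}

lemma Reachable.of_deleteEdges_or {u v x y : V} (h : G.Reachable x y) :
    (G.deleteEdges {s(u, v)}).Reachable x y ∨
    ((G.deleteEdges {s(u, v)}).Reachable x u ∧ (G.deleteEdges {s(u, v)}).Reachable v y) ∨
    ((G.deleteEdges {s(u, v)}).Reachable x v ∧ (G.deleteEdges {s(u, v)}).Reachable u y) := by
  obtain ⟨w⟩ := h
  induction w with
  | nil => exact Or.inl (Reachable.refl _)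
  | @cons a b c hab _ ih =>
    by_cases he : s(a, b) = s(u, v)
    · rw [Sym2.eq_iff] at he
      rcases he with ⟨rfl, rfl⟩ | ⟨rfl, rfl⟩
      · rcases ih with h | ⟨h, h'⟩ | ⟨h, h'⟩
        · exact Or.inr (Or.inl ⟨Reachable.refl _, h⟩)
        · exact Or.inr (Or.inl ⟨Reachable.refl _, h'⟩)
        · exact Or.inl h'
      · rcases ih with h | ⟨h, h'⟩ | ⟨h, h'⟩
        · exact Or.inr (Or.inr ⟨Reachable.refl _, h⟩)
        · exact Or.inl h'
        · exact Or.inr (Or.inr ⟨Reachable.refl _, h'⟩)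
    · have hr : (G.deleteEdges {s(u, v)}).Reachable a b := by
        apply Adj.reachable
        rw [deleteEdges_adj]
        exact ⟨hab, he⟩
      rcases ih with h | ⟨h, h'⟩ | ⟨h, h'⟩
      · exact Or.inl (hr.trans h)
      · exact Or.inr (Or.inl ⟨hr.trans h, h'⟩)
      · exact Or.inr (Or.inr ⟨hr.trans h, h'⟩)

/-- Restoring uv can only merge the component of v with that of u, so injectivity can fail only at
the component of v. -/
lemma card_connectedComponent_deleteEdges_le [Finite V] (u v : V) :
    Nat.card (G.deleteEdges {s(u, v)}).ConnectedComponent ≤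
      Nat.card G.ConnectedComponent + 1 := by
  refine Nat.card_le_card_add_one_of_injOn_compl
    (ConnectedComponent.map (Hom.ofLE (deleteEdges_le _)))
    ((G.deleteEdges {s(u, v)}).connectedComponentMk v) ?_
  intro x y
  induction x using ConnectedComponent.ind with | _ x
  induction y using ConnectedComponent.ind with | _ y
  intro h hx hy
  simp only [ConnectedComponent.map_mk, ne_eq, ConnectedComponent.eq] at h hx hy ⊢
  rcases Reachable.of_deleteEdges_or (u := u) (v := v) h with h | ⟨-, h⟩ | ⟨h, -⟩
  · exact h
  · exact absurd h.symm hy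
  · exact absurd h hx

lemma card_connectedComponent_deleteEdges_le_of_reachable [Finite V] {u v : V}
    (huv : (G.deleteEdges {s(u, v)}).Reachable u v) :
    Nat.card (G.deleteEdges {s(u, v)}).ConnectedComponent ≤ Nat.card G.ConnectedComponent := by
  refine Nat.card_le_card_of_injective
    (ConnectedComponent.map (Hom.ofLE (deleteEdges_le _))) ?_
  intro x y
  induction x using ConnectedComponent.ind with | _ x
  induction y using ConnectedComponent.ind with | _ y
  intro h
  simp only [ConnectedComponent.map_mk, ConnectedComponent.eq] at h ⊢
  rcases Reachable.of_deleteEdges_or (u := u) (v := v) h with h | ⟨h, h'⟩ | ⟨h, h'⟩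
  · exact h
  · exact (h.trans huv).trans h'
  · exact (h.trans huv.symm).trans h'

namespace RotationSystem

lemma facePerm_apply (R : RotationSystem G) (d : G.Dart) : R.facePerm d = R.next d.symm := rfl

lemma facePerm_fst (R : RotationSystem G) (d : G.Dart) : (R.facePerm d).fst = d.snd := by
  rw [facePerm_apply, R.fst_next]
  rfl

/-- The facial walk through d leads from the head of d back to its tail, and by hypothesis never
traverses the edge backwards. -/
lemma reachable_of_not_sameCycle [Fintype V] (R : RotationSystem G) (d : G.Dart)
    (h : ¬ R.facePerm.SameCycle d d.symm) :
    (G.deleteEdges {s(d.fst, d.snd)}).Reachable d.fst d.snd := by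
  classical
  have key : ∀ n : ℕ,
      (G.deleteEdges {s(d.fst, d.snd)}).Reachable d.snd ((R.facePerm ^ n) d).snd := by
    intro n
    induction n with
    | zero => exact Reachable.refl _
    | succ n ih =>
      rw [pow_succ', mul_apply]
      set x := (R.facePerm ^ n) d with hx
      by_cases h1 : R.facePerm x = d
      · rw [h1]
      have h2 : R.facePerm x ≠ d.symm := by
        intro h2
        apply h
        rw [← h2, hx, ← mul_apply, ← pow_succ']
        exact ⟨((n + 1 : ℕ) : ℤ), by rw [zpow_natCast]⟩
      refine ih.trans ?_
      rw [← R.facePerm_fst x]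
      apply Adj.reachable
      rw [deleteEdges_adj]
      refine ⟨(R.facePerm x).adj, ?_⟩
      intro h3
      have h4 : (R.facePerm x).edge = d.edge := h3
      rw [dart_edge_eq_iff] at h4
      tauto
  have hs : R.facePerm.SameCycle d (R.facePerm⁻¹ d) := ⟨-1, by simp⟩
  obtain ⟨n, -, hn⟩ := hs.exists_pow_eq'
  have := key n
  rw [hn, ← R.facePerm_fst (R.facePerm⁻¹ d), show R.facePerm (R.facePerm⁻¹ d) = d from
    R.facePerm.apply_symm_apply d] at this
  exact this.symm

lemma eq_of_next_eq_self (R : RotationSystem G) {d e : G.Dart} (h : R.next d = d)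
    (he : e.fst = d.fst) : e = d := by
  have := SameCycle.apply_eq_of_invariant (f := fun x => x = d) (π := R.next) (fun z => by
    simp only [eq_iff_iff]
    constructor
    · intro h'
      exact R.next.injective (h'.trans h.symm)
    · rintro rfl
      exact h) (R.sameCycle_of_fst_eq e d he)
  simpa using this

variable [Fintype V]

lemma eulerChar_eq (R : RotationSystem G) : R.eulerChar =
    (Nat.card V : ℤ) - Nat.card G.edgeSet + R.facePerm.cycleCount +
      Nat.card {v : V // ∀ w, ¬ G.Adj v w} := by
  classical
  rw [eulerChar, Face, Nat.card_sum, cycleCount]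
  push_cast
  ring

/-- Writing χ = 2c − 2g, this says that g does not increase. Either one face borders the edge on
both sides, and deletion splits it while adding at most one component, or two faces merge and the
components stay the same. -/
lemma exists_deleteEdges (R : RotationSystem G) (d : G.Dart) :
    ∃ (R' : RotationSystem (G.deleteEdges {s(d.fst, d.snd)})),
      R.eulerChar + 2 * Nat.card (G.deleteEdges {s(d.fst, d.snd)}).ConnectedComponent ≤
        R'.eulerChar + 2 * Nat.card G.ConnectedComponent := by
  classical
  obtain ⟨H, hH⟩ : ∃ H, H = G.deleteEdges {s(d.fst, d.snd)} := ⟨_, rfl⟩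
  have hadj : ∀ x y, H.Adj x y ↔ G.Adj x y ∧ s(x, y) ≠ s(d.fst, d.snd) := by
    intro x y
    rw [hH, deleteEdges_adj]
    rfl
  let d' := d.symm
  have hdd' : d ≠ d' := d.symm_ne.symm
  have hfst : d.fst ≠ d'.fst := d.adj.ne
  let ι : H.Dart → G.Dart := fun x => ⟨x.toProd, ((hadj _ _).1 x.adj).1⟩
  have ιinj : Function.Injective ι := by
    intro x y h
    have h' : (ι x).toProd = (ι y).toProd := congrArg Dart.toProd h
    exact Dart.ext _ _ h'
  have ιsymm : ∀ x, ι x.symm = (ι x).symm := fun x => rfl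
  have hedge : ∀ x : G.Dart, (x ≠ d ∧ x ≠ d') ↔ s(x.fst, x.snd) ≠ s(d.fst, d.snd) := by
    intro x
    have : (x.edge = d.edge) ↔ _ := dart_edge_eq_iff x d
    change _ ↔ ¬ (x.edge = d.edge)
    rw [this]
    tauto
  have ιne : ∀ x, ι x ≠ d ∧ ι x ≠ d' := fun x => (hedge _).2 ((hadj _ _).1 x.adj).2
  have ιsurj : ∀ x, x ≠ d ∧ x ≠ d' → ∃ y, ι y = x := by
    intro x hx
    exact ⟨⟨x.toProd, (hadj _ _).2 ⟨x.adj, (hedge x).1 hx⟩⟩, rfl⟩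
  let σ := R.next
  have hσd' : σ d ≠ d' := fun h => hfst (by rw [← h, R.fst_next])
  have hσd : σ d' ≠ d := fun h => hfst (by rw [← h, R.fst_next])
  -- Excise d and then d' from the rotation, leaving both as fixed points.
  let σ₁ := Equiv.swap d (σ d) * σ
  have hσ₁d : σ₁ d = d := swap_mul_apply_self σ d
  have hσ₁d' : σ₁ d' = σ d' := swap_mul_apply_of_ne σ hdd'.symm hσd
  let σ₂ := Equiv.swap d' (σ₁ d') * σ₁
  have hσ₂d : σ₂ d = d := by
    have : σ₂ d = σ₁ d := swap_mul_apply_of_ne σ₁ hdd' (by rw [hσ₁d]; exact hdd')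
    rw [this, hσ₁d]
  have hσ₂d' : σ₂ d' = d' := swap_mul_apply_self σ₁ d'
  have hσ₁fst : ∀ x, (σ₁ x).fst = x.fst := by
    intro x
    by_cases hx : x = d
    · rw [hx, hσ₁d]
    by_cases hx' : σ x = d
    · have : σ₁ x = σ d := by
        change Equiv.swap d (σ d) (σ x) = _
        rw [hx', Equiv.swap_apply_left]
      rw [this, R.fst_next, ← hx', R.fst_next]
    · rw [show σ₁ x = σ x from swap_mul_apply_of_ne σ hx hx', R.fst_next]
  have hσ₂fst : ∀ x, (σ₂ x).fst = x.fst := by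
    intro x
    by_cases hx : x = d'
    · rw [hx, hσ₂d']
    by_cases hx' : σ₁ x = d'
    · have : σ₂ x = σ₁ d' := by
        change Equiv.swap d' (σ₁ d') (σ₁ x) = _
        rw [hx', Equiv.swap_apply_left]
      rw [this, hσ₁fst, ← hx', hσ₁fst]
    · rw [show σ₂ x = σ₁ x from swap_mul_apply_of_ne σ₁ hx hx', hσ₁fst]
  have hpres : ∀ x, (σ₂ x ≠ d ∧ σ₂ x ≠ d') ↔ (x ≠ d ∧ x ≠ d') := by
    intro x
    have h1 : σ₂ x = d ↔ x = d := by
      conv_lhs => rw [← hσ₂d]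
      exact σ₂.injective.eq_iff
    have h2 : σ₂ x = d' ↔ x = d' := by
      conv_lhs => rw [← hσ₂d']
      exact σ₂.injective.eq_iff
    simp only [ne_eq, h1, h2]
  let e : H.Dart ≃ {x : G.Dart // x ≠ d ∧ x ≠ d'} :=
    Equiv.ofBijective (fun x => ⟨ι x, ιne x⟩)
      ⟨fun x y h => ιinj (congrArg Subtype.val h), fun x => by
        obtain ⟨y, hy⟩ := ιsurj x.1 x.2
        exact ⟨y, Subtype.ext hy⟩⟩
  let next' : Equiv.Perm H.Dart := e.symm.permCongr (σ₂.subtypePerm hpres)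
  have hnext' : ∀ x, ι (next' x) = σ₂ (ι x) := by
    intro x
    have h1 : ∀ y, ι (e.symm y) = y.1 := by
      intro y
      have := congrArg Subtype.val (e.apply_symm_apply y)
      exact this
    change ι (e.symm _) = _
    rw [h1]
    rfl
  have hpow : ∀ (n : ℕ) x, ι ((next' ^ n) x) = (σ₂ ^ n) (ι x) := by
    intro n x
    induction n with
    | zero => rfl
    | succ n ih => rw [pow_succ', pow_succ', mul_apply, mul_apply, hnext', ih]
  let R' : RotationSystem H :=
    { next := next'
      fst_next := fun x => by
        have : (ι (next' x)).fst = (ι x).fst := by rw [hnext', hσ₂fst]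
        exact this
      sameCycle_of_fst_eq := fun x y hxy => by
        have h1 : σ.SameCycle (ι x) (ι y) := R.sameCycle_of_fst_eq _ _ hxy
        have h2 : σ₁.SameCycle (ι x) (ι y) := h1.swap_mul (ιne x).1 (ιne y).1
        have h3 : σ₂.SameCycle (ι x) (ι y) := h2.swap_mul (ιne x).2 (ιne y).2
        obtain ⟨n, -, hn⟩ := h3.exists_pow_eq'
        rw [← hpow] at hn
        exact ⟨n, by rw [zpow_natCast]; exact ιinj hn⟩ }
  let φ := R.facePerm
  -- The swap cancels the reversal on d and d', so `φ₁` agrees with σ there. Excising both darts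
  -- then gives ψ, which is the new face permutation together with two fixed points.
  let φ₁ := φ * Equiv.swap d d'
  have hφ₁d : φ₁ d = σ d := by
    change φ (Equiv.swap d d' d) = _
    rw [Equiv.swap_apply_left]
    change σ d.symm.symm = _
    rw [Dart.symm_symm]
  have hφ₁d' : φ₁ d' = σ d' := by
    change φ (Equiv.swap d d' d') = _
    rw [Equiv.swap_apply_right]
    rfl
  let φ₂ := Equiv.swap d (φ₁ d) * φ₁
  have hφ₂d : φ₂ d = d := swap_mul_apply_self φ₁ d
  have hφ₂d' : φ₂ d' = σ d' := by
    rw [← hφ₁d']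
    exact swap_mul_apply_of_ne φ₁ hdd'.symm (by rw [hφ₁d']; exact hσd)
  let ψ := Equiv.swap d' (φ₂ d') * φ₂
  have hψ : ∀ x, ψ (ι x) = ι (R'.facePerm x) := by
    intro x
    rw [facePerm_apply]
    change _ = ι (next' _)
    rw [hnext', ιsymm]
    change Equiv.swap d' (φ₂ d') (Equiv.swap d (φ₁ d) (φ (Equiv.swap d d' (ι x)))) =
      Equiv.swap d' (σ₁ d') (Equiv.swap d (σ d) (φ (ι x)))
    rw [hφ₂d', hφ₁d, hσ₁d', Equiv.swap_apply_of_ne_of_ne (ιne x).1 (ιne x).2]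
  -- Excision gains a cycle unless the dart is already fixed. In that case its tail has degree 1 and
  -- becomes isolated, and `c4` recovers the missing face as that of an isolated vertex.
  have c1 : φ₁.cycleCount + (if σ d = d then 0 else 1) ≤ φ₂.cycleCount := by
    have := cycleCount_add_le_swap_mul φ₁ d
    rw [hφ₁d] at this
    simpa only [φ₂, hφ₁d] using this
  have c2 : φ₂.cycleCount + (if σ d' = d' then 0 else 1) ≤ ψ.cycleCount := by
    have := cycleCount_add_le_swap_mul φ₂ d'
    rw [hφ₂d'] at this
    simpa only [ψ, hφ₂d'] using this
  have c3 : ψ.cycleCount ≤ R'.facePerm.cycleCount + 2 := by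
    let f : Option (Option (Quotient (SameCycle.setoid R'.facePerm))) →
        Quotient (SameCycle.setoid ψ)
      | none => cycleMk ψ d
      | some none => cycleMk ψ d'
      | some (some x) => Quotient.lift (fun z => cycleMk ψ (ι z))
          (fun _ _ h => SameCycle.apply_eq_of_invariant (f := fun z => cycleMk ψ (ι z))
            (fun z => by rw [← hψ, cycleMk_apply]) h) x
    have := Nat.card_le_card_of_surjective f fun x => by
      induction x using Quotient.inductionOn with
      | h z =>
        by_cases hz : z = d
        · exact ⟨none, by rw [hz]; rfl⟩
        by_cases hz' : z = d'
        · exact ⟨some none, by rw [hz']; rfl⟩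
        obtain ⟨y, rfl⟩ := ιsurj z ⟨hz, hz'⟩
        exact ⟨some (some (cycleMk _ y)), rfl⟩
    rwa [Finite.card_option, Finite.card_option] at this
  have hiso : σ d = d → ∀ w, ¬ H.Adj d.fst w := by
    intro h w hw
    obtain ⟨h1, h2⟩ := (hadj _ _).1 hw
    have h3 := R.eq_of_next_eq_self (e := ⟨(d.fst, w), h1⟩) h rfl
    exact h2 (congrArg Dart.edge h3)
  have hiso' : σ d' = d' → ∀ w, ¬ H.Adj d'.fst w := by
    intro h w hw
    obtain ⟨h1, h2⟩ := (hadj _ _).1 hw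
    have h3 := R.eq_of_next_eq_self (e := ⟨(d'.fst, w), h1⟩) h rfl
    exact h2 ((congrArg Dart.edge h3).trans d.edge_symm)
  have c4 : Nat.card {v : V // ∀ w, ¬ G.Adj v w} + (if σ d = d then 1 else 0) +
      (if σ d' = d' then 1 else 0) ≤ Nat.card {v : V // ∀ w, ¬ H.Adj v w} := by
    let I : Finset V := Finset.univ.filter fun v => ∀ w, ¬ G.Adj v w
    let A : Finset V := if σ d = d then {d.fst} else ∅
    let B : Finset V := if σ d' = d' then {d'.fst} else ∅
    have hA : A.card = if σ d = d then 1 else 0 := by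
      dsimp only [A]
      split_ifs <;> simp
    have hB : B.card = if σ d' = d' then 1 else 0 := by
      dsimp only [B]
      split_ifs <;> simp
    have hmA : ∀ x ∈ A, σ d = d ∧ x = d.fst := by
      intro x hx
      dsimp only [A] at hx
      split_ifs at hx <;> simp_all
    have hmB : ∀ x ∈ B, σ d' = d' ∧ x = d'.fst := by
      intro x hx
      dsimp only [B] at hx
      split_ifs at hx <;> simp_all
    rw [Nat.card_eq_fintype_card, Nat.card_eq_fintype_card, Fintype.card_subtype,
      Fintype.card_subtype, ← hA, ← hB]
    have hIA : Disjoint I A := by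
      rw [Finset.disjoint_left]
      intro x hx hxA
      rw [(hmA x hxA).2] at hx
      exact (Finset.mem_filter.1 hx).2 _ d.adj
    have hIB : Disjoint (I ∪ A) B := by
      rw [Finset.disjoint_left]
      intro x hx hxB
      rw [(hmB x hxB).2] at hx
      rcases Finset.mem_union.1 hx with hx | hx
      · exact (Finset.mem_filter.1 hx).2 _ d'.adj
      · exact hfst (hmA _ hx).2.symm
    change I.card + _ + _ ≤ _
    rw [← Finset.card_union_of_disjoint hIA, ← Finset.card_union_of_disjoint hIB]
    refine Finset.card_le_card ?_
    intro x hx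
    rw [Finset.mem_filter]
    refine ⟨Finset.mem_univ _, ?_⟩
    rcases Finset.mem_union.1 hx with hx | hx
    · rcases Finset.mem_union.1 hx with hx | hx
      · intro w hw
        exact (Finset.mem_filter.1 hx).2 w ((hadj _ _).1 hw).1
      · rw [(hmA _ hx).2]
        exact hiso (hmA _ hx).1
    · rw [(hmB _ hx).2]
      exact hiso' (hmB _ hx).1
  have c5 : Nat.card H.edgeSet + 1 = Nat.card G.edgeSet := by
    rw [hH, edgeSet_deleteEdges, Nat.card_coe_set_eq, Nat.card_coe_set_eq]
    exact Set.ncard_sdiff_singleton_add_one d.edge_mem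
  subst hH
  refine ⟨R', ?_⟩
  rw [eulerChar_eq, eulerChar_eq]
  -- In the first case χ grows by at least 2 and c by at most 1; in the second neither χ decreases
  -- nor c increases.
  by_cases hs : φ.SameCycle d d'
  · have c6 : R.facePerm.cycleCount + 1 ≤ φ₁.cycleCount := cycleCount_add_one_le_mul_swap hdd' hs
    have c7 := G.card_connectedComponent_deleteEdges_le d.fst d.snd
    split_ifs at c1 c2 c4 <;> omega
  · have c6 : R.facePerm.cycleCount ≤ φ₁.cycleCount + 1 := cycleCount_le_mul_swap_add_one φ d d'
    have c7 := card_connectedComponent_deleteEdges_le_of_reachable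
      (R.reachable_of_not_sameCycle d hs)
    split_ifs at c1 c2 c4 <;> omega

end RotationSystem

end Deletion

end SimpleGraph

/-! ### Face counting and discharging -/

namespace Equiv.Perm

/-- If no cycle of `φ` is shorter than `3`, then the number of cycles is controlled by the
number of points on cycles of length `3`. -/
lemma twelve_mul_cycleCount_le {D : Type*} [Fintype D] [DecidableEq D] (φ : Perm D)
    (h1 : ∀ x, φ x ≠ x) (h2 : ∀ x, φ (φ x) ≠ x) :
    12 * φ.cycleCount ≤ 3 * Fintype.card D +
      (Finset.univ.filter fun x => φ (φ (φ x)) = x).card := by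
  classical
  rw [cycleCount, Nat.card_eq_fintype_card, ← Finset.card_univ (α := D), ← Finset.card_univ]
  rw [Finset.card_eq_sum_card_fiberwise (f := cycleMk φ) (s := Finset.univ (α := D))
    (t := Finset.univ) (fun _ _ => Finset.mem_coe.2 (Finset.mem_univ _)),
    Finset.card_eq_sum_card_fiberwise (f := cycleMk φ)
    (s := Finset.univ.filter fun x => φ (φ (φ x)) = x)
    (t := Finset.univ) (fun _ _ => Finset.mem_coe.2 (Finset.mem_univ _)), Finset.mul_sum,
    ← Finset.sum_add_distrib, mul_comm, ← smul_eq_mul]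
  refine Finset.card_nsmul_le_sum _ _ _ fun q _ => ?_
  induction q using Quotient.inductionOn with | h x
  have hm : ∀ y, cycleMk φ y = cycleMk φ x → cycleMk φ (φ y) = cycleMk φ x := fun y hy => by
    rw [cycleMk_apply, hy]
  have hx : cycleMk φ x = cycleMk φ x := rfl
  have n1 := h1 x
  have n2 := h2 x
  have n3 := h1 (φ x)
  have n4 := h1 (φ (φ x))
  have n5 := h2 (φ x)
  -- A cycle of length 3 contributes 3·3 + 3 = 12, a longer one at least 3·4 = 12.
  by_cases h : φ (φ (φ x)) = x
  · have hs : ({x, φ x, φ (φ x)} : Finset D).card = 3 := by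
      rw [Finset.card_eq_three]
      exact ⟨_, _, _, n1.symm, n2.symm, n3.symm, rfl⟩
    have a1 : 3 ≤ (Finset.univ.filter fun y => cycleMk φ y = cycleMk φ x).card := by
      rw [← hs]
      refine Finset.card_le_card fun y hy => ?_
      simp only [Finset.mem_insert, Finset.mem_singleton] at hy
      rw [Finset.mem_filter]
      refine ⟨Finset.mem_univ _, ?_⟩
      rcases hy with rfl | rfl | rfl
      exacts [hx, hm _ hx, hm _ (hm _ hx)]
    have a2 : 3 ≤ ((Finset.univ.filter fun x => φ (φ (φ x)) = x).filter
        fun y => cycleMk φ y = cycleMk φ x).card := by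
      rw [← hs]
      refine Finset.card_le_card fun y hy => ?_
      simp only [Finset.mem_insert, Finset.mem_singleton] at hy
      rw [Finset.mem_filter, Finset.mem_filter]
      refine ⟨⟨Finset.mem_univ _, ?_⟩, ?_⟩
      · rcases hy with rfl | rfl | rfl <;> simp [h]
      · rcases hy with rfl | rfl | rfl
        exacts [hx, hm _ hx, hm _ (hm _ hx)]
    change 12 ≤ 3 * (Finset.univ.filter fun y => cycleMk φ y = cycleMk φ x).card +
      ((Finset.univ.filter fun x => φ (φ (φ x)) = x).filter
        fun y => cycleMk φ y = cycleMk φ x).card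
    omega
  · have hs : ({x, φ x, φ (φ x), φ (φ (φ x))} : Finset D).card = 4 := by
      rw [Finset.card_insert_of_notMem, Finset.card_insert_of_notMem,
        Finset.card_insert_of_notMem, Finset.card_singleton]
      · simp [n4.symm]
      · simp [n3.symm, n5.symm]
      · simp [n1.symm, n2.symm, Ne.symm h]
    have a1 : 4 ≤ (Finset.univ.filter fun y => cycleMk φ y = cycleMk φ x).card := by
      rw [← hs]
      refine Finset.card_le_card fun y hy => ?_
      simp only [Finset.mem_insert, Finset.mem_singleton] at hy
      rw [Finset.mem_filter]
      refine ⟨Finset.mem_univ _, ?_⟩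
      rcases hy with rfl | rfl | rfl | rfl
      exacts [hx, hm _ hx, hm _ (hm _ hx), hm _ (hm _ (hm _ hx))]
    change 12 ≤ 3 * (Finset.univ.filter fun y => cycleMk φ y = cycleMk φ x).card + _
    omega

end Equiv.Perm

namespace SimpleGraph

universe u

open Equiv.Perm

variable {V : Type u} {G : SimpleGraph V}

/-- The component of an edge is not an isolated vertex. This extra component gives the strict
inequality in the discharging. -/
lemma card_isolated_add_one_le [Finite V] (hne : ∃ u v, G.Adj u v) :
    Nat.card {v : V // ∀ w, ¬ G.Adj v w} + 1 ≤ Nat.card G.ConnectedComponent := by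
  classical
  obtain ⟨u, v, huv⟩ := hne
  have hiso : ∀ x y, G.Reachable x y → (∀ w, ¬ G.Adj x w) → x = y := by
    rintro x y ⟨w⟩ hx
    cases w with
    | nil => rfl
    | cons h _ => exact absurd h (hx _)
  rw [← Finite.card_option]
  refine Nat.card_le_card_of_injective
    (fun o : Option {v : V // ∀ w, ¬ G.Adj v w} =>
      G.connectedComponentMk (o.elim u Subtype.val)) ?_
  intro x y h
  rcases x with _ | x <;> rcases y with _ | y <;>
    simp only [Option.elim, ConnectedComponent.eq] at h
  · rfl
  · exact absurd (hiso _ _ h.symm y.2 ▸ huv : G.Adj y.1 v) (y.2 v)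
  · exact absurd (hiso _ _ h x.2 ▸ huv : G.Adj x.1 v) (x.2 v)
  · exact congrArg some (Subtype.ext (hiso _ _ h x.2))

namespace RotationSystem

/-- The dart before `d` in the cyclic order around its starting vertex. -/
def prev (R : RotationSystem G) (d : G.Dart) : G.Dart := R.next.symm d

lemma next_prev (R : RotationSystem G) (d : G.Dart) : R.next (R.prev d) = d :=
  R.next.apply_symm_apply d

lemma prev_injective (R : RotationSystem G) : Function.Injective R.prev := R.next.symm.injective

lemma prev_fst (R : RotationSystem G) (d : G.Dart) : (R.prev d).fst = d.fst := by
  rw [← R.fst_next, next_prev]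

/-- The dart `d` lies on a facial walk of length `3`. -/
def IsTri (R : RotationSystem G) (d : G.Dart) : Prop :=
  R.facePerm (R.facePerm (R.facePerm d)) = d

variable {R : RotationSystem G}

lemma IsTri.facePerm {d : G.Dart} (h : R.IsTri d) : R.IsTri (R.facePerm d) :=
  congrArg R.facePerm h

/-- The face of d occupies the corner between `prev d` and d, so a triangular face has the heads of
these two darts as its other vertices. -/
lemma IsTri.prev_eq {d : G.Dart} (h : R.IsTri d) :
    R.prev d = (R.facePerm (R.facePerm d)).symm := by
  apply R.next.injective
  rw [next_prev, ← facePerm_apply]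
  exact h.symm

lemma IsTri.adj_snd {d : G.Dart} (h : R.IsTri d) : G.Adj d.snd (R.prev d).snd := by
  rw [h.prev_eq]
  change G.Adj d.snd (R.facePerm (R.facePerm d)).fst
  rw [facePerm_fst, ← facePerm_fst]
  exact (R.facePerm d).adj

lemma prev_adj (R : RotationSystem G) (d : G.Dart) : G.Adj d.fst (R.prev d).snd := by
  rw [← R.prev_fst]
  exact (R.prev d).adj

variable [Fintype V] [DecidableEq V] [DecidableRel G.Adj]

/-- A facial walk of length 2 would turn back at the head of d, forcing that vertex to have degree
1. -/
lemma facePerm_facePerm_ne {d : G.Dart} (h : 2 ≤ G.degree d.snd) :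
    R.facePerm (R.facePerm d) ≠ d := by
  intro h'
  have h1 : R.facePerm d = d.symm := by
    apply Dart.ext
    apply Prod.ext
    · exact R.facePerm_fst d
    · rw [← R.facePerm_fst, h']
      rfl
  have h2 : R.next d.symm = d.symm := h1
  rw [← dart_fst_fiber_card_eq_degree] at h
  have h3 : (Finset.univ.filter fun e : G.Dart => e.fst = d.snd) ⊆ {d.symm} := fun e he => by
    rw [Finset.mem_singleton]
    exact R.eq_of_next_eq_self h2 (Finset.mem_filter.1 he).2
  have := Finset.card_le_card h3
  rw [Finset.card_singleton] at this
  omega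

/-- Triangles at consecutive corners share the edge of `prev d`, so they form a kite unless their
third vertices coincide. Then the rotation at the vertex has length at most 2, against the degree
bound. -/
lemma not_isTri_prev (hk : ¬ G.HasKite) {d : G.Dart} (hd : 3 ≤ G.degree d.fst)
    (h : R.IsTri d) : ¬ R.IsTri (R.prev d) := by
  intro h'
  have h1 : d.snd = (R.prev (R.prev d)).snd := by
    by_contra hne
    refine hk ⟨d.fst, (R.prev d).snd, d.snd, (R.prev (R.prev d)).snd, hne, R.prev_adj d, d.adj,
      h.adj_snd.symm, ?_, h'.adj_snd⟩
    have := R.prev_adj (R.prev d)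
    rwa [R.prev_fst] at this
  have h2 : R.prev (R.prev d) = d := by
    apply Dart.ext
    apply Prod.ext
    · rw [R.prev_fst, R.prev_fst]
    · exact h1.symm
  have h3 : R.next d = R.prev d := by
    conv_lhs => rw [← h2]
    exact R.next_prev _
  have h4 : (Finset.univ.filter fun e : G.Dart => e.fst = d.fst) ⊆ {d, R.prev d} := by
    intro e he
    have he := (Finset.mem_filter.1 he).2
    have := SameCycle.apply_eq_of_invariant (f := fun x => x = d ∨ x = R.prev d) (π := R.next)
      (fun z => by
        simp only [eq_iff_iff]
        constructor
        · rintro (h' | h')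
          · right
            rw [← h']
            exact (R.next.symm_apply_apply z).symm
          · left
            exact R.next.injective (h'.trans h3.symm)
        · rintro (rfl | rfl)
          · exact Or.inr h3
          · exact Or.inl (R.next_prev _)) (R.sameCycle_of_fst_eq e d he)
    simpa using this
  rw [← dart_fst_fiber_card_eq_degree] at hd
  have := (Finset.card_le_card h4).trans Finset.card_le_two
  omega

open scoped Classical in
/-- Discharging: a plane graph without kites whose maximum degree is at most `K`, where
`7 ≤ K`, has a light edge. -/
lemma exists_light_edge (R : RotationSystem G)
    (hR : 2 * (Nat.card G.ConnectedComponent : ℤ) ≤ R.eulerChar) (hk : ¬ G.HasKite) {K : ℕ}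
    (hK : 7 ≤ K) (hdeg : ∀ v, G.degree v ≤ K) (hne : ∃ u v, G.Adj u v) :
    ∃ u v, G.Adj u v ∧ G.degree u ≤ 4 ∧ G.degree u + G.degree v ≤ K + 2 := by
  by_contra hcon
  have hheavy : ∀ u v, G.Adj u v → G.degree u ≤ 4 → K + 3 ≤ G.degree u + G.degree v := by
    intro u v huv hu
    by_contra h
    exact hcon ⟨u, v, huv, hu, by omega⟩
  clear hcon
  -- A neighbour of a vertex of degree at most 2 would have degree at least K + 1.
  have hdeg3 : ∀ u v, G.Adj u v → 3 ≤ G.degree u := by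
    intro u v huv
    have h1 := hdeg v
    by_contra h
    have := hheavy u v huv (by omega)
    omega
  have hdart : ∀ d : G.Dart, 3 ≤ G.degree d.fst := fun d => hdeg3 _ _ d.adj
  have hdisj : ∀ d, R.IsTri d → ¬ R.IsTri (R.prev d) := fun d => not_isTri_prev hk (hdart d)
  set φ := R.facePerm with hφ
  have hsum : ∀ (P : G.Dart → Prop) [DecidablePred P],
      ∑ v, ((Finset.univ.filter P).filter fun d => d.fst = v).card =
        (Finset.univ.filter P).card := fun P _ =>
    (Finset.card_eq_sum_card_fiberwise (f := fun d : G.Dart => d.fst) (t := Finset.univ)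
      (fun _ _ => Finset.mem_coe.2 (Finset.mem_univ _))).symm
  let S : V → Finset G.Dart := fun v => Finset.univ.filter fun d => d.fst = v
  have hS : ∀ v, (S v).card = G.degree v := fun v => by
    rw [← dart_fst_fiber_card_eq_degree]
  let N : V → Finset G.Dart := fun v =>
    (Finset.univ.filter fun d => G.degree d.snd = 3).filter fun d => d.fst = v
  let T : V → Finset G.Dart := fun v =>
    (Finset.univ.filter fun d => R.IsTri d).filter fun d => d.fst = v
  let TH : V → Finset G.Dart := fun v =>
    (Finset.univ.filter fun d => R.IsTri d ∧ ¬ G.degree d.fst ≤ 4).filter fun d => d.fst = v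
  let S3 : V → Finset G.Dart := fun v =>
    (Finset.univ.filter fun d => G.degree d.fst = 3).filter fun d => d.fst = v
  -- Triangular corners are never consecutive, so they and their predecessors are disjoint sets of
  -- darts at v.
  have hTS : ∀ v, 2 * (T v).card ≤ (S v).card := by
    intro v
    have hd : Disjoint (T v) ((T v).image R.prev) := by
      rw [Finset.disjoint_left]
      intro d hd hd'
      obtain ⟨e, he, rfl⟩ := Finset.mem_image.1 hd'
      simp only [T, Finset.mem_filter, Finset.mem_univ, true_and] at hd he
      exact hdisj e he.1 hd.1
    have := Finset.card_le_card (s := T v ∪ (T v).image R.prev) (t := S v) (by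
      intro d hd
      rw [Finset.mem_union, Finset.mem_image] at hd
      simp only [S, T, Finset.mem_filter, Finset.mem_univ, true_and] at hd ⊢
      rcases hd with hd | ⟨e, he, rfl⟩
      · exact hd.2
      · rw [R.prev_fst, he.2])
    rw [Finset.card_union_of_disjoint hd, Finset.card_image_of_injective _ R.prev_injective]
      at this
    omega
  -- The two outer vertices of a triangular corner are adjacent, hence not both of degree 3. Assign
  -- to the corner a bounding dart whose head is not a 3-vertex; non-consecutive corners get
  -- different darts.
  have hNT : ∀ v, (N v).card + (T v).card ≤ (S v).card := by
    intro v
    have h1 : (T v).card ≤ ((S v).filter fun d => ¬ G.degree d.snd = 3).card := by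
      refine Finset.card_le_card_of_injOn
        (fun d => if G.degree d.snd = 3 then R.prev d else d) ?_ ?_
      · intro d hd
        simp only [T, Finset.mem_coe, Finset.mem_filter, Finset.mem_univ, true_and] at hd
        rw [Finset.mem_coe]
        dsimp only
        split_ifs with h <;>
          simp only [S, Finset.mem_filter, Finset.mem_univ, true_and]
        · refine ⟨by rw [R.prev_fst, hd.2], fun h' => ?_⟩
          have := hheavy _ _ hd.1.adj_snd (by omega)
          omega
        · exact ⟨hd.2, h⟩
      · intro d hd e he h
        simp only [T, Finset.mem_coe, Finset.mem_filter, Finset.mem_univ, true_and] at hd he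
        dsimp only at h
        split_ifs at h
        · exact R.prev_injective h
        · exact absurd (h ▸ he.1) (hdisj d hd.1)
        · exact absurd (h ▸ hd.1) (hdisj e he.1)
        · exact h
    have h2 := Finset.card_filter_add_card_filter_not (s := S v) (fun d => G.degree d.snd = 3)
    have h3 : N v = (S v).filter fun d => G.degree d.snd = 3 := by
      simp only [N, S, Finset.filter_filter, and_comm]
    rw [h3]
    omega
  -- Final charge is nonnegative. The critical case is degree d ≥ 7: 2N + 3T ≤ 2(N + T) + T ≤ 5d/2 ≤
  -- 6d − 24, where the last inequality needs d ≥ 7.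
  have hlocal : ∀ v, (if ∀ w, ¬ G.Adj v w then 0 else 24) + 2 * (N v).card +
      3 * (TH v).card ≤ 6 * (S v).card + 2 * (S3 v).card := by
    intro v
    have h1 := hTS v
    have h2 := hNT v
    have h3 : (TH v).card ≤ (T v).card := by
      refine Finset.card_le_card fun d hd => ?_
      simp only [T, TH, Finset.mem_filter, Finset.mem_univ, true_and] at hd ⊢
      tauto
    have h4 : G.degree v ≤ 4 → (TH v).card = 0 := by
      intro h
      rw [Finset.card_eq_zero, Finset.eq_empty_iff_forall_notMem]
      intro d hd
      simp only [TH, Finset.mem_filter, Finset.mem_univ, true_and] at hd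
      exact hd.1.2 (hd.2 ▸ h)
    have h5 : G.degree v = 3 → (S3 v).card = (S v).card := by
      intro h
      congr 1
      ext d
      simp only [S, S3, Finset.mem_filter, Finset.mem_univ, true_and]
      constructor
      · exact And.right
      · rintro rfl
        exact ⟨h, rfl⟩
    have h6 : (N v).card = 0 ∨ 7 ≤ G.degree v := by
      rw [Finset.card_eq_zero]
      rcases (N v).eq_empty_or_nonempty with h | ⟨d, hd⟩
      · exact Or.inl h
      · right
        simp only [N, Finset.mem_filter, Finset.mem_univ, true_and] at hd
        have := hheavy _ _ d.adj.symm (by omega)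
        rw [hd.2] at this
        omega
    have h7 := hS v
    split_ifs with hiso
    · have : G.degree v = 0 := by
        rw [← card_neighborFinset_eq_degree, Finset.card_eq_zero,
          Finset.eq_empty_iff_forall_notMem]
        intro w hw
        exact hiso w ((mem_neighborFinset _ _ _).1 hw)
      omega
    · push Not at hiso
      obtain ⟨w, hw⟩ := hiso
      have := hdeg3 v w hw
      omega
  have hNsum : ∑ v, (N v).card =
      (Finset.univ.filter fun d : G.Dart => G.degree d.snd = 3).card := hsum _
  have hTHsum : ∑ v, (TH v).card =
      (Finset.univ.filter fun d => R.IsTri d ∧ ¬ G.degree d.fst ≤ 4).card := hsum _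
  have hS3sum : ∑ v, (S3 v).card =
      (Finset.univ.filter fun d : G.Dart => G.degree d.fst = 3).card := hsum _
  have htotal := Finset.sum_le_sum fun v (_ : v ∈ Finset.univ) => hlocal v
  rw [Finset.sum_add_distrib, Finset.sum_add_distrib, Finset.sum_add_distrib, ← Finset.mul_sum,
    ← Finset.mul_sum, ← Finset.mul_sum, ← Finset.mul_sum,
    hNsum, hTHsum, hS3sum] at htotal
  have hSsum : ∑ v, (S v).card = Fintype.card G.Dart := by
    rw [← Finset.card_univ]
    exact (Finset.card_eq_sum_card_fiberwise (f := fun d : G.Dart => d.fst) (t := Finset.univ)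
      (fun _ _ => Finset.mem_coe.2 (Finset.mem_univ _))).symm
  have hiso : ∑ v : V, (if ∀ w, ¬ G.Adj v w then 0 else 24) +
      24 * Nat.card {v : V // ∀ w, ¬ G.Adj v w} = 24 * Nat.card V := by
    rw [Nat.card_eq_fintype_card, Fintype.card_subtype, Nat.card_eq_fintype_card,
      ← Finset.card_univ, Finset.card_filter, Finset.card_eq_sum_ones, Finset.mul_sum,
      Finset.mul_sum, ← Finset.sum_add_distrib]
    refine Finset.sum_congr rfl fun v _ => ?_
    split_ifs <;> rfl
  -- Reversing darts matches the charge given to 3-vertices with the charge they receive.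
  have hN3 : (Finset.univ.filter fun d : G.Dart => G.degree d.snd = 3).card =
      (Finset.univ.filter fun d : G.Dart => G.degree d.fst = 3).card := by
    refine Finset.card_bij' (fun d _ => d.symm) (fun d _ => d.symm) ?_ ?_
      (fun d _ => d.symm_symm) (fun d _ => d.symm_symm) <;>
    · simp only [Finset.mem_filter, Finset.mem_univ, true_and]
      exact fun _ h => h
  -- A corner of degree at most 4 is followed on its triangle by two corners of larger degree.
  have hTL : 2 * (Finset.univ.filter fun d => R.IsTri d ∧ G.degree d.fst ≤ 4).card ≤
      (Finset.univ.filter fun d => R.IsTri d ∧ ¬ G.degree d.fst ≤ 4).card := by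
    set TL := Finset.univ.filter fun d => R.IsTri d ∧ G.degree d.fst ≤ 4 with hTLdef
    have hTLmem : ∀ d, d ∈ TL ↔ R.IsTri d ∧ G.degree d.fst ≤ 4 := by simp [hTLdef]
    have hh : ∀ d ∈ TL, ¬ G.degree (φ d).fst ≤ 4 := by
      intro d hd
      have hd := (hTLmem d).1 hd
      rw [R.facePerm_fst]
      have := hheavy _ _ d.adj hd.2
      omega
    have hh' : ∀ d ∈ TL, ¬ G.degree (φ (φ d)).fst ≤ 4 := by
      intro d hd
      have hd := (hTLmem d).1 hd
      have h1 : (φ (φ d)).snd = d.fst := by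
        rw [← R.facePerm_fst]
        exact congrArg (fun d : G.Dart => d.fst) hd.1
      have h2 := (φ (φ d)).adj.symm
      rw [h1] at h2
      have := hheavy _ _ h2 hd.2
      omega
    have hd : Disjoint (TL.image φ) (TL.image fun d => φ (φ d)) := by
      rw [Finset.disjoint_left]
      intro d hd hd'
      obtain ⟨x, hx, rfl⟩ := Finset.mem_image.1 hd
      obtain ⟨y, hy, hxy⟩ := Finset.mem_image.1 hd'
      have := φ.injective hxy
      exact hh y hy (this ▸ ((hTLmem x).1 hx).2)
    have := Finset.card_le_card (s := TL.image φ ∪ TL.image fun d => φ (φ d))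
      (t := Finset.univ.filter fun d => R.IsTri d ∧ ¬ G.degree d.fst ≤ 4) (by
        intro d hd
        rw [Finset.mem_union, Finset.mem_image, Finset.mem_image] at hd
        rw [Finset.mem_filter]
        refine ⟨Finset.mem_univ _, ?_⟩
        rcases hd with ⟨e, he, rfl⟩ | ⟨e, he, rfl⟩
        · exact ⟨((hTLmem e).1 he).1.facePerm, hh e he⟩
        · exact ⟨((hTLmem e).1 he).1.facePerm.facePerm, hh' e he⟩)
    rw [Finset.card_union_of_disjoint hd, Finset.card_image_of_injective _ φ.injective,
      Finset.card_image_of_injective (f := fun d => φ (φ d)) _ (φ.injective.comp φ.injective)] at this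
    omega
  have hT : (Finset.univ.filter fun d => R.IsTri d ∧ G.degree d.fst ≤ 4).card +
      (Finset.univ.filter fun d => R.IsTri d ∧ ¬ G.degree d.fst ≤ 4).card =
      (Finset.univ.filter fun d => R.IsTri d).card := by
    rw [← Finset.filter_filter, ← Finset.filter_filter]
    exact Finset.card_filter_add_card_filter_not _
  have hF : 12 * φ.cycleCount ≤ 3 * Fintype.card G.Dart +
      (Finset.univ.filter fun d => R.IsTri d).card := by
    convert twelve_mul_cycleCount_le φ (fun d h => ?_) (fun d => facePerm_facePerm_ne ?_)
    · rfl
    · have := R.facePerm_fst d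
      rw [← hφ, h] at this
      exact d.adj.ne this
    · have := hdart d.symm
      exact le_trans (by norm_num) this
  have hE : Fintype.card G.Dart = 2 * Nat.card G.edgeSet := by
    rw [G.dart_card_eq_twice_card_edges, Nat.card_eq_fintype_card, edgeFinset_card]
  have hC := card_isolated_add_one_le hne
  rw [R.eulerChar_eq, ← hφ] at hR
  rw [hSsum, hN3] at htotal
  -- With D darts, T of them on triangles, and n non-isolated vertices, Euler's formula and the face
  -- count give 24n + 2T ≥ 6D + 48. The local inequalities sum to 24n + 3·TH ≤ 6D, and 2T ≤ 3·TH.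
  omega

end RotationSystem

end SimpleGraph

/-! ### Extending list colourings -/

namespace SimpleGraph

universe u

variable {V : Type u}

lemma HasKite.mono {G H : SimpleGraph V} (h : G ≤ H) : G.HasKite → H.HasKite := by
  rintro ⟨a, b, c, d, h1, h2, h3, h4, h5, h6⟩
  exact ⟨a, b, c, d, h1, h h2, h h3, h h4, h h5, h h6⟩

/-- A vertex colouring and an edge colouring form a proper total colouring. -/
structure IsTotalColoringPair (G : SimpleGraph V) {α : Type*} (c : V → α) (c' : Sym2 V → α) :
    Prop where
  vertex : ∀ u v, G.Adj u v → c u ≠ c v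
  incident : ∀ u v, G.Adj u v → c u ≠ c' s(u, v)
  edge : ∀ u v w, G.Adj u v → G.Adj u w → v ≠ w → c' s(u, v) ≠ c' s(u, w)

lemma IsTotalColoringPair.isProperTotalColoring {G : SimpleGraph V} {α : Type*} {c : V → α}
    {c' : Sym2 V → α} (h : G.IsTotalColoringPair c c') :
    G.IsProperTotalColoring (Sum.elim c fun e : G.edgeSet => c' e) := by
  rintro (x | ⟨e, he⟩) (y | ⟨f, hf⟩) hxy
  · exact h.vertex x y hxy
  · obtain ⟨z, rfl⟩ := Sym2.mem_iff_exists.1 (show x ∈ f from hxy)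
    exact h.incident x z hf
  · obtain ⟨z, rfl⟩ := Sym2.mem_iff_exists.1 (show y ∈ e from hxy)
    exact (h.incident y z he).symm
  · obtain ⟨hef, v, hv, hv'⟩ := hxy
    obtain ⟨z, rfl⟩ := Sym2.mem_iff_exists.1 (show v ∈ e from hv)
    obtain ⟨w, rfl⟩ := Sym2.mem_iff_exists.1 (show v ∈ f from hv')
    exact h.edge v z w he hf (fun hzw => hef (by subst hzw; rfl))

variable [Fintype V]

open scoped Classical in
/-- A proper total list colouring of `G - uv` can be modified at `u` and extended to `uv` if `u` has
small degree and `uv` has small weight. -/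
lemma exists_totalColoringPair_of_deleteEdges {G : SimpleGraph V} {α : Type*} {k : ℕ} {u v : V}
    (huv : G.Adj u v) (hu : 2 * G.degree u < k) (huv' : G.degree u + G.degree v ≤ k)
    (L : V → Finset α) (L' : Sym2 V → Finset α) (hL : ∀ x, k ≤ (L x).card)
    (hL' : ∀ x, k ≤ (L' x).card) {c : V → α} {c' : Sym2 V → α}
    (hc : (G.deleteEdges {s(u, v)}).IsTotalColoringPair c c') (hcL : ∀ x, c x ∈ L x)
    (hcL' : ∀ x, c' x ∈ L' x) :
    ∃ c c', G.IsTotalColoringPair c c' ∧ (∀ x, c x ∈ L x) ∧ ∀ x, c' x ∈ L' x := by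
  have hadj : ∀ x y, G.Adj x y → s(x, y) ≠ s(u, v) → (G.deleteEdges {s(u, v)}).Adj x y :=
    fun x y h h' => deleteEdges_adj.2 ⟨h, h'⟩
  -- The colour of u is ignored, since u is recoloured below. This leaves at most 1 + (deg u − 1) +
  -- (deg v − 1) < k forbidden colours.
  let F : Finset α := insert (c v) (((G.neighborFinset u).erase v).image (fun w => c' s(u, w)) ∪
    ((G.neighborFinset v).erase u).image (fun w => c' s(v, w)))
  have hF : F.card < k := by
    have h1 := Finset.card_insert_le (c v)
      (((G.neighborFinset u).erase v).image (fun w => c' s(u, w)) ∪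
        ((G.neighborFinset v).erase u).image (fun w => c' s(v, w)))
    have h2 := Finset.card_union_le (((G.neighborFinset u).erase v).image (fun w => c' s(u, w)))
      (((G.neighborFinset v).erase u).image (fun w => c' s(v, w)))
    have h3 := Finset.card_image_le (s := (G.neighborFinset u).erase v)
      (f := fun w => c' s(u, w))
    have h4 := Finset.card_image_le (s := (G.neighborFinset v).erase u)
      (f := fun w => c' s(v, w))
    have h5 := Finset.card_erase_add_one ((G.mem_neighborFinset u v).2 huv)
    have h6 := Finset.card_erase_add_one ((G.mem_neighborFinset v u).2 huv.symm)
    rw [card_neighborFinset_eq_degree] at h5 h6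
    change F.card ≤ _ at h1
    omega
  obtain ⟨a, haL, haF⟩ := Finset.exists_mem_notMem_of_card_lt_card (hF.trans_le (hL' s(u, v)))
  simp only [F, Finset.mem_insert, Finset.mem_union, Finset.mem_image, Finset.mem_erase,
    mem_neighborFinset, not_or, not_exists, not_and, and_imp] at haF
  obtain ⟨ha1, ha2, ha3⟩ := haF
  let e' : Sym2 V → α := Function.update c' s(u, v) a
  have he' : e' s(u, v) = a := Function.update_self _ _ _
  have he'' : ∀ x, x ≠ s(u, v) → e' x = c' x := fun x hx => Function.update_of_ne hx _ _
  let F' : Finset α := (G.neighborFinset u).image c ∪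
    (G.neighborFinset u).image (fun w => e' s(u, w))
  have hF' : F'.card < k := by
    have h2 := Finset.card_union_le ((G.neighborFinset u).image c)
      ((G.neighborFinset u).image (fun w => e' s(u, w)))
    have h3 := Finset.card_image_le (s := G.neighborFinset u) (f := c)
    have h4 := Finset.card_image_le (s := G.neighborFinset u) (f := fun w => e' s(u, w))
    rw [card_neighborFinset_eq_degree] at h3 h4
    change F'.card ≤ _ at h2
    omega
  obtain ⟨b, hbL, hbF⟩ := Finset.exists_mem_notMem_of_card_lt_card (hF'.trans_le (hL u))
  simp only [F', Finset.mem_union, Finset.mem_image, mem_neighborFinset, not_or, not_exists,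
    not_and] at hbF
  obtain ⟨hb1, hb2⟩ := hbF
  let e : V → α := Function.update c u b
  have heu : e u = b := Function.update_self _ _ _
  have hex : ∀ x, x ≠ u → e x = c x := fun x hx => Function.update_of_ne hx _ _
  have haw : ∀ x y w, G.Adj x w → s(x, y) = s(u, v) → y ≠ w → c' s(x, w) ≠ a := by
    intro x y w hxw hxy hyw
    rw [Sym2.eq_iff] at hxy
    rcases hxy with ⟨rfl, rfl⟩ | ⟨rfl, rfl⟩
    · exact ha2 w hyw.symm hxw
    · exact ha3 w hyw.symm hxw
  refine ⟨e, e', ⟨?_, ?_, ?_⟩, ?_, ?_⟩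
  · intro x y hxy
    by_cases hx : x = u
    · subst hx
      rw [heu, hex y hxy.ne']
      exact Ne.symm (hb1 y hxy)
    by_cases hy : y = u
    · subst hy
      rw [heu, hex x hxy.ne]
      exact hb1 x hxy.symm
    rw [hex x hx, hex y hy]
    refine hc.vertex x y (hadj x y hxy fun h => ?_)
    rw [Sym2.eq_iff] at h
    tauto
  · intro x y hxy
    by_cases hx : x = u
    · subst hx
      rw [heu]
      exact Ne.symm (hb2 y hxy)
    rw [hex x hx]
    by_cases h : s(x, y) = s(u, v)
    · rw [h, he']
      rw [Sym2.eq_iff] at h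
      rcases h with h | h
      · exact absurd h.1 hx
      · rw [h.1]
        exact Ne.symm ha1
    · rw [he'' _ h]
      exact hc.incident x y (hadj x y hxy h)
  · intro x y w hxy hxw hyw
    by_cases h : s(x, y) = s(u, v)
    · have h' : s(x, w) ≠ s(u, v) := fun h' => hyw (Sym2.congr_right.1 (h.trans h'.symm))
      rw [he'' _ h', h, he']
      exact (haw x y w hxw h hyw).symm
    by_cases h' : s(x, w) = s(u, v)
    · rw [he'' _ h, h', he']
      exact haw x w y hxy h' hyw.symm
    rw [he'' _ h, he'' _ h']
    exact hc.edge x y w (hadj x y hxy h) (hadj x w hxw h') hyw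
  · intro x
    by_cases hx : x = u
    · rw [hx, heu]
      exact hbL
    · rw [hex x hx]
      exact hcL x
  · intro x
    by_cases hx : x = s(u, v)
    · rw [hx, he']
      exact haL
    · rw [he'' x hx]
      exact hcL' x

-- The bound K stays fixed because the maximum degree may drop under deletion, and lists sit on all
-- of `Sym2 V` so that they do not depend on G. Planarity enters only as 2c ≤ χ, the inequality
-- preserved by `exists_deleteEdges`.
open scoped Classical in
lemma exists_totalColoringPair {α : Type*} {K : ℕ} (hK : 7 ≤ K) (L : V → Finset α)
    (L' : Sym2 V → Finset α) (hL : ∀ x, K + 2 ≤ (L x).card) (hL' : ∀ x, K + 2 ≤ (L' x).card)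
    (n : ℕ) : ∀ G : SimpleGraph V, Nat.card G.edgeSet = n → ¬ G.HasKite →
      (∀ v, G.degree v ≤ K) →
      (∃ R : RotationSystem G, 2 * (Nat.card G.ConnectedComponent : ℤ) ≤ R.eulerChar) →
      ∃ c c', G.IsTotalColoringPair c c' ∧ (∀ x, c x ∈ L x) ∧ ∀ x, c' x ∈ L' x := by
  induction n with
  | zero =>
    intro G hn _ _ _
    have hno : ∀ u v, ¬ G.Adj u v := by
      intro u v h
      have : G.edgeSet = ∅ := by
        rw [Nat.card_coe_set_eq, Set.ncard_eq_zero] at hn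
        exact hn
      exact (Set.eq_empty_iff_forall_notMem.1 this) s(u, v) h
    choose c hc using fun x => Finset.card_pos.1 (lt_of_lt_of_le (by omega) (hL x))
    choose c' hc' using fun x => Finset.card_pos.1 (lt_of_lt_of_le (by omega) (hL' x))
    exact ⟨c, c', ⟨fun _ _ h => absurd h (hno _ _), fun _ _ h => absurd h (hno _ _),
      fun _ _ _ h => absurd h (hno _ _)⟩, hc, hc'⟩
  | succ n ih =>
    rintro G hn hk hdeg ⟨R, hR⟩
    have hne : ∃ u v, G.Adj u v := by
      by_contra hno
      push Not at hno
      have : G.edgeSet = ∅ := Set.eq_empty_iff_forall_notMem.2 fun e => by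
        induction e using Sym2.ind with | _ u v
        exact hno u v
      rw [this] at hn
      simp at hn
    obtain ⟨u, v, huv, hu, hw⟩ := R.exists_light_edge hR hk hK hdeg hne
    obtain ⟨R', hR'⟩ := R.exists_deleteEdges ⟨(u, v), huv⟩
    have hcard : Nat.card (G.deleteEdges {s(u, v)}).edgeSet = n := by
      have h := Set.ncard_sdiff_singleton_add_one (s := G.edgeSet) (a := s(u, v)) huv
      rw [edgeSet_deleteEdges, Nat.card_coe_set_eq]
      rw [Nat.card_coe_set_eq] at hn
      omega
    obtain ⟨c, c', hc, hcL, hcL'⟩ := ih (G.deleteEdges {s(u, v)}) hcard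
      (fun h => hk (h.mono (deleteEdges_le _)))
      (fun w => by
        refine le_trans (le_of_eq ?_) ((degree_le_of_le (G := G.deleteEdges {s(u, v)})
          (v := w) (deleteEdges_le _)).trans (hdeg w))
        congr!)
      ⟨R', by
        dsimp only at hR'
        omega⟩
    -- Here 2 deg u ≤ 8 < 9 ≤ K + 2.
    exact exists_totalColoringPair_of_deleteEdges huv (by omega) hw L L' hL hL' hc hcL hcL'

end SimpleGraph

theorem mainTheorem4 {V : Type*} [Fintype V] (G : SimpleGraph V) [DecidableRel G.Adj]
    (hplanar : G.IsPlanar) (hkite : ¬ G.HasKite) (hΔ : 7 ≤ G.maxDegree) :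
    G.listTotalChromaticNumber ≤ ((G.maxDegree + 2 : ℕ) : ℕ∞) := by
  classical
  refine iInf₂_le _ ?_
  intro α L hL
  obtain ⟨R, hR⟩ := hplanar
  obtain ⟨x₀⟩ : Nonempty V := by
    by_contra h
    rw [not_nonempty_iff] at h
    rw [SimpleGraph.maxDegree_of_subsingleton] at hΔ
    omega
  obtain ⟨c, c', hc, hcL, hcL'⟩ := SimpleGraph.exists_totalColoringPair hΔ (fun v => L (Sum.inl v))
    -- Non-edges receive an arbitrary list that is large enough; its colours are discarded at the
    -- end.
    (fun e => if h : e ∈ G.edgeSet then L (Sum.inr ⟨e, h⟩) else L (Sum.inl x₀))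
    (fun v => hL _) (fun e => by split_ifs <;> exact hL _) _ G rfl hkite
    (fun v => by convert G.degree_le_maxDegree v) ⟨R, hR.ge⟩
  refine ⟨_, hc.isProperTotalColoring, ?_⟩
  rintro (v | ⟨e, he⟩)
  · exact hcL v
  · have := hcL' e
    rwa [dif_pos he] at this
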